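/- Let $k$ be a field and let $H$ be a numerical semigroup, i.e. a submonoid of $(\mathbb{N},+)$ with $\mathbb{N}\setminus H$ finite, with Frobenius number $f=\max(\mathbb{N}\setminus H)$ (in particular $H\neq\mathbb{N}$). Let $R=k[[H]]\subseteq k[[t]]$ be the ring of all power series $\sum_{h\in H}c_h t^h$ with $c_h\in k$. Then $R$ has minimal canonical conductor if and only if $f-1$ is a quasi-Frobenius number of $H$, that is, $f-1\notin H$ and $f-1+h\in H$ for all $0\neq h\in H$. Here, for $R$-submodules $A,B$ of the fraction field $Q$ of $R$, write $A:B=\{x\in Q : xB\subseteq A\}$. A canonical ideal of $R$ is a nonzero ideal $\omega$ with $\omega:(\omega:I)=I$ for every nonzero fractional ideal $I$ of $R$. For a canonical ideal $\omega$, let $R^{\omega}=\bigcup_{n\ge 0}(\omega^n:\omega^n)$ be its blowup algebra; for a ring $R\subseteq S\subseteq Q$, let $\mathrm{co}(R,S)=\{r\in S : rS\subseteq R\}$. The ring $R$ has minimal canonical conductor if $\mathrm{co}(R,R^{\omega})=\mathrm{co}(R,\overline{R})$ for some canonical ideal $\omega$, where $\overline{R}$ is the integral closure of $R$ in $Q$.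 -/

import Mathlib

open scoped nonZeroDivisors PowerSeries

/-- The set `QF(H)` of quasi-Frobenius numbers of `H`: the natural numbers `x` outside `H`
with `x + h ∈ H` for all nonzero `h ∈ H`. -/
def quasiFrobeniusNumbers (H : AddSubmonoid ℕ) : Set ℕ :=
  {x | x ∉ H ∧ ∀ h ∈ H, h ≠ 0 → x + h ∈ H}

/-- The semigroup ring `k[[H]]`, as a subalgebra of `k[[t]]`: the power series all of whose
exponents lie in `H`. -/
def semigroupRing (k : Type*) [Field k] (H : AddSubmonoid ℕ) : Subalgebra k k⟦X⟧ where
  carrier := {p | ∀ n, n ∉ H → PowerSeries.coeff n p = 0}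
  mul_mem' := by
    intro a b ha hb n hn
    rw [PowerSeries.coeff_mul]
    refine Finset.sum_eq_zero fun ij hij => ?_
    rw [Finset.HasAntidiagonal.mem_antidiagonal] at hij
    by_cases h1 : ij.1 ∈ H
    · by_cases h2 : ij.2 ∈ H
      · exact absurd (hij ▸ H.add_mem h1 h2) hn
      · rw [hb _ h2, mul_zero]
    · rw [ha _ h1, zero_mul]
  add_mem' := by
    intro a b ha hb n hn
    rw [map_add, ha n hn, hb n hn, add_zero]
  algebraMap_mem' := by
    intro r n hn
    have h0 : n ≠ 0 := fun h => hn (h ▸ H.zero_mem)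
    simp [PowerSeries.coeff_C, h0]

/-- Canonical ideals of a one dimensional Noetherian local domain `R` (Herzog and Kunz): nonzero
ideals `ω` such that `ω : (ω : I) = I` for every nonzero fractional ideal `I`, where
`A : B = {x ∈ Frac R | x B ⊆ A}`. -/
def IsCanonicalIdeal (R : Type*) [CommRing R] [IsDomain R] (ω : Ideal R) : Prop :=
  ω ≠ ⊥ ∧ ∀ I : FractionalIdeal R⁰ (FractionRing R), I ≠ 0 →
    (ω : FractionalIdeal R⁰ (FractionRing R)) / ((ω : FractionalIdeal R⁰ (FractionRing R)) / I) = I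

/-- `I ^ n : I ^ n ⊆ I ^ (n + m) : I ^ (n + m)`. -/
theorem mul_mem_coeSubmodule_pow_add {R : Type*} [CommRing R] {I : Ideal R} {x : FractionRing R} {n : ℕ}
    (hx : ∀ y ∈ IsLocalization.coeSubmodule (FractionRing R) (I ^ n),
      x * y ∈ IsLocalization.coeSubmodule (FractionRing R) (I ^ n))
    (m : ℕ) {y : FractionRing R}
    (hy : y ∈ IsLocalization.coeSubmodule (FractionRing R) (I ^ (n + m))) :
    x * y ∈ IsLocalization.coeSubmodule (FractionRing R) (I ^ (n + m)) := by
  rw [pow_add, IsLocalization.coeSubmodule_mul] at hy ⊢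
  refine Submodule.mul_induction_on hy (fun a ha b hb => ?_) (fun a b ha hb => ?_)
  · rw [← mul_assoc]
    exact Submodule.mul_mem_mul (hx a ha) hb
  · rw [mul_add]
    exact Submodule.add_mem _ ha hb

/-- The blowup algebra `R^I`, the union over `n` of the rings `I ^ n : I ^ n` in `Frac R`. -/
def blowupAlgebra (R : Type*) [CommRing R] (I : Ideal R) : Subalgebra R (FractionRing R) where
  carrier := {x | ∃ n : ℕ, ∀ y ∈ IsLocalization.coeSubmodule (FractionRing R) (I ^ n),
    x * y ∈ IsLocalization.coeSubmodule (FractionRing R) (I ^ n)}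
  mul_mem' := by
    rintro a b ⟨n, hn⟩ ⟨m, hm⟩
    refine ⟨n + m, fun y hy => ?_⟩
    rw [mul_assoc]
    refine mul_mem_coeSubmodule_pow_add hn m ?_
    rw [add_comm] at hy ⊢
    exact mul_mem_coeSubmodule_pow_add hm n hy
  add_mem' := by
    rintro a b ⟨n, hn⟩ ⟨m, hm⟩
    refine ⟨n + m, fun y hy => ?_⟩
    rw [add_mul]
    refine Submodule.add_mem _ (mul_mem_coeSubmodule_pow_add hn m hy) ?_
    rw [add_comm] at hy ⊢
    exact mul_mem_coeSubmodule_pow_add hm n hy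
  algebraMap_mem' := by
    intro r
    refine ⟨0, fun y hy => ?_⟩
    rw [← Algebra.smul_def]
    exact Submodule.smul_mem _ r hy

/-- The conductor `co(R, S) = {r ∈ S | r S ⊆ R}` of a birational extension `R ⊆ S ⊆ Frac R`. -/
def birationalConductor (R : Type*) [CommRing R] (S : Subalgebra R (FractionRing R)) :
    Set (FractionRing R) :=
  {r | r ∈ S ∧ ∀ s ∈ S, r * s ∈ Set.range (algebraMap R (FractionRing R))}

/-- A (one dimensional, singular, analytically unramified, local) domain `R` has minimal canonical
conductor if `b(ω) = co(R)` for a canonical ideal `ω`. Here `b(ω) = co(R, R^ω)` is the conductor of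
the blowup algebra of `ω`, and `co(R)` is the conductor of the normalisation of `R`. -/
def HasMinimalCanonicalConductor (R : Type*) [CommRing R] [IsDomain R] : Prop :=
  ∃ ω : Ideal R, IsCanonicalIdeal R ω ∧
    birationalConductor R (blowupAlgebra R ω) =
      birationalConductor R (integralClosure R (FractionRing R))

/-! ### `k[[t]]` as the integral closure of `k[[H]]`. -/

namespace semigroupRing

open PowerSeries

variable {k : Type*} [Field k] {H : AddSubmonoid ℕ} {c : ℕ}

/-! Since `1 ∉ H`, the condition on `f - 1` just says `f - 1 ∉ H`. Inside `Frac R`, the integral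
closure is `k[[t]]`.

If `f - 1 ∉ H`, the monomial canonical ideal `ω` contains `t^(f+1)` and `t^(f+2)`. Hence `ω^f =
t^((f+1)f) k[[t]]`, the blowup algebra is all of `k[[t]]`, and the two conductors agree. That `ω` is
canonical is linear duality: a functional killing an ideal is a coefficient of multiplication by
some `y` (`exists_separating`).

If `f - 1 ∈ H`, take any canonical `ω` and `g ∈ ω` of least order. An element `g v` of `ω` with
nonzero `t`-coefficient in `v` would give `t^f ω ⊆ ω`, so `t^f ∈ ω : ω = R`, which is absurd
(`X_pow_mem_of_isCanonicalIdeal`). So the blowup algebra consists of series without `t`-term. Then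
`t^(f-1)` lies in its conductor, but not in that of `k[[t]]`, as `t^(f-1) t = t^f ∉ R`. -/

theorem X_pow_mem {n : ℕ} (hn : n ∈ H) : (X ^ n : k⟦X⟧) ∈ semigroupRing k H := by
  intro m hm
  rw [coeff_X_pow, if_neg]
  rintro rfl
  exact hm hn

theorem X_pow_mul_mem {n : ℕ} (hn : ∀ m, n ≤ m → m ∈ H) (v : k⟦X⟧) :
    X ^ n * v ∈ semigroupRing k H := by
  intro m hm
  rw [coeff_X_pow_mul', if_neg fun h => hm (hn m h)]

/-- The embedding of `k[[t]]` into the fraction field of `k[[H]]`. -/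
noncomputable def toFrac (hc : ∀ m, c ≤ m → m ∈ H) :
    k⟦X⟧ →+* FractionRing (semigroupRing k H) where
  toFun v := algebraMap (semigroupRing k H) _ ⟨X ^ c * v, X_pow_mul_mem hc v⟩ /
    algebraMap (semigroupRing k H) _ ⟨X ^ c, X_pow_mem (hc c le_rfl)⟩
  map_one' := by
    have h : algebraMap (semigroupRing k H) (FractionRing (semigroupRing k H))
        ⟨X ^ c, X_pow_mem (hc c le_rfl)⟩ ≠ 0 := by
      rw [Ne, IsFractionRing.to_map_eq_zero_iff, Subtype.ext_iff]
      exact pow_ne_zero _ X_ne_zero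
    simp only [mul_one]
    exact div_self h
  map_mul' v w := by
    have h : algebraMap (semigroupRing k H) (FractionRing (semigroupRing k H))
        ⟨X ^ c, X_pow_mem (hc c le_rfl)⟩ ≠ 0 := by
      rw [Ne, IsFractionRing.to_map_eq_zero_iff, Subtype.ext_iff]
      exact pow_ne_zero _ X_ne_zero
    rw [div_mul_div_comm, div_eq_div_iff h (mul_ne_zero h h), ← map_mul, ← map_mul, ← map_mul,
      ← map_mul]
    congr 1
    ext1
    simp only [MulMemClass.coe_mul]
    ring
  map_zero' := by
    rw [div_eq_zero_iff, IsFractionRing.to_map_eq_zero_iff, Subtype.ext_iff]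
    exact Or.inl (mul_zero _)
  map_add' v w := by
    rw [← add_div, ← map_add]
    congr 2
    ext1
    exact mul_add _ _ _

theorem toFrac_coe (hc : ∀ m, c ≤ m → m ∈ H) (r : semigroupRing k H) :
    toFrac hc (r : k⟦X⟧) = algebraMap _ _ r := by
  have h : algebraMap (semigroupRing k H) (FractionRing (semigroupRing k H))
      ⟨X ^ c, X_pow_mem (hc c le_rfl)⟩ ≠ 0 := by
    rw [Ne, IsFractionRing.to_map_eq_zero_iff, Subtype.ext_iff]
    exact pow_ne_zero _ X_ne_zero
  change algebraMap (semigroupRing k H) (FractionRing (semigroupRing k H)) _ /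
    algebraMap (semigroupRing k H) (FractionRing (semigroupRing k H)) _ = _
  rw [div_eq_iff h, ← map_mul]
  congr 1
  ext1
  exact mul_comm _ _

theorem toFrac_of_mem (hc : ∀ m, c ≤ m → m ∈ H) {v : k⟦X⟧} (hv : v ∈ semigroupRing k H) :
    toFrac hc v = algebraMap (semigroupRing k H) _ ⟨v, hv⟩ :=
  toFrac_coe hc ⟨v, hv⟩

theorem toFrac_injective (hc : ∀ m, c ≤ m → m ∈ H) :
    Function.Injective (toFrac (k := k) hc) := by
  refine (injective_iff_map_eq_zero _).2 fun v hv => ?_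
  have h : toFrac hc (X ^ c * v) = 0 := by rw [map_mul, hv, mul_zero]
  rw [toFrac_of_mem hc (X_pow_mul_mem hc v), IsFractionRing.to_map_eq_zero_iff,
    Subtype.ext_iff] at h
  exact (mul_eq_zero.1 h).resolve_left (pow_ne_zero _ X_ne_zero)

theorem toFrac_mem_range_iff (hc : ∀ m, c ≤ m → m ∈ H) {v : k⟦X⟧} :
    toFrac hc v ∈ Set.range (algebraMap (semigroupRing k H) (FractionRing (semigroupRing k H))) ↔
      v ∈ semigroupRing k H := by
  constructor
  · rintro ⟨r, hr⟩
    rw [← toFrac_coe hc] at hr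
    exact toFrac_injective hc hr ▸ r.2
  · exact fun hv => ⟨⟨v, hv⟩, (toFrac_of_mem hc hv).symm⟩

/-- A denominator-cleared form of elements of the fraction field. -/
theorem exists_eq_div (x : FractionRing (semigroupRing k H)) :
    ∃ p q : semigroupRing k H, q ≠ 0 ∧ x * algebraMap _ _ q = algebraMap _ _ p := by
  obtain ⟨⟨p, q⟩, h⟩ := IsLocalization.surj (semigroupRing k H)⁰ x
  exact ⟨p, q, nonZeroDivisors.coe_ne_zero q, h⟩

theorem coe_trunc_eq_sum (n : ℕ) (v : k⟦X⟧) :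
    (trunc n v : k⟦X⟧) = ∑ i ∈ Finset.range n, coeff i v • X ^ i := by
  ext m
  simp [coeff_trunc, coeff_X_pow]

theorem isIntegral_toFrac (hc : ∀ m, c ≤ m → m ∈ H) (v : k⟦X⟧) :
    IsIntegral (semigroupRing k H) (toFrac hc v) := by
  have hX : IsIntegral (semigroupRing k H) (toFrac (k := k) hc X) := by
    -- The exponent must be positive, and `c` may be `0`.
    refine IsIntegral.of_pow (n := c + 1) (Nat.succ_pos c) ?_
    rw [← map_pow, toFrac_of_mem hc (X_pow_mem (hc _ (Nat.le_succ c)))]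
    exact isIntegral_algebraMap
  have hC (a : k) : IsIntegral (semigroupRing k H) (toFrac hc (C a)) := by
    have ha : C a ∈ semigroupRing k H := (semigroupRing k H).algebraMap_mem a
    rw [toFrac_of_mem hc ha]
    exact isIntegral_algebraMap
  rw [eq_X_pow_mul_shift_add_trunc c v, map_add]
  refine IsIntegral.add ?_ ?_
  · rw [toFrac_of_mem hc (X_pow_mul_mem hc _)]
    exact isIntegral_algebraMap
  · rw [coe_trunc_eq_sum, map_sum]
    refine IsIntegral.sum _ fun i _ => ?_
    rw [smul_eq_C_mul, map_mul, map_pow]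
    exact (hC _).mul (hX.pow i)

theorem exists_eq_of_isIntegralElem {V Q : Type*} [CommRing V] [IsIntegrallyClosed V]
    [Field Q] (j : V →+* Q) (hj : Function.Injective j) (hj' : ∀ z, ∃ x y, z = j x / j y)
    {x : Q} (hx : j.IsIntegralElem x) : ∃ v, j v = x := by
  let _ : Algebra V Q := j.toAlgebra
  have : FaithfulSMul V Q := (faithfulSMul_iff_algebraMap_injective _ _).2 hj
  have : IsFractionRing V Q := IsFractionRing.of_field _ _ hj'
  exact IsIntegrallyClosed.isIntegral_iff.1 hx

theorem mem_integralClosure_iff (hc : ∀ m, c ≤ m → m ∈ H)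
    {x : FractionRing (semigroupRing k H)} :
    x ∈ integralClosure (semigroupRing k H) (FractionRing (semigroupRing k H)) ↔
      ∃ v, toFrac hc v = x := by
  constructor
  · rintro ⟨p, hp, hx⟩
    have hj : (toFrac hc).comp (semigroupRing k H).subtype = algebraMap _ _ :=
      RingHom.ext (toFrac_coe hc)
    refine exists_eq_of_isIntegralElem (toFrac hc) (toFrac_injective hc) (fun z => ?_)
      ⟨p.map (semigroupRing k H).subtype, hp.map _, ?_⟩
    · obtain ⟨p, q, hq, h⟩ := exists_eq_div z
      refine ⟨p, q, ?_⟩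
      rw [toFrac_coe, toFrac_coe, ← h, mul_div_cancel_right₀]
      rwa [Ne, IsFractionRing.to_map_eq_zero_iff]
    · rwa [Polynomial.eval₂_map, hj]
  · rintro ⟨v, rfl⟩
    exact isIntegral_toFrac hc v

end semigroupRing

/-! ### Canonical ideals by duality. -/

/-- It is enough to test double duality on the ideals of `R`. -/
theorem isCanonicalIdeal_of_separating {R : Type*} [CommRing R] [IsDomain R] {ω : Ideal R}
    (hω : ω ≠ ⊥) (h : ∀ J : Ideal R, J ≠ ⊥ → ∀ p ∉ J, ∃ y : FractionRing R,
      (∀ v ∈ J, ∃ z ∈ ω, y * algebraMap R _ v = algebraMap R _ z) ∧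
      ∀ z ∈ ω, y * algebraMap R _ p ≠ algebraMap R _ z) :
    IsCanonicalIdeal R ω := by
  refine ⟨hω, fun I hI => ?_⟩
  obtain ⟨d, hd, hdI⟩ := I.isFractional
  have hd0 : d ≠ 0 := nonZeroDivisors.ne_zero hd
  -- Division by the zero ideal is `0` by convention, so the outer colon can only be unfolded once
  -- this is known.
  have hJ : (ω : FractionalIdeal R⁰ (FractionRing R)) / I ≠ 0 := by
    obtain ⟨w, hw, hw0⟩ := (Submodule.ne_bot_iff _).1 hω
    intro h
    have hmem : algebraMap R (FractionRing R) (d * w) ∈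
        (ω : FractionalIdeal R⁰ (FractionRing R)) / I := by
      refine (FractionalIdeal.mem_div_iff_of_ne_zero hI).2 fun i hi => ?_
      obtain ⟨r, hr⟩ := hdI i hi
      refine (FractionalIdeal.mem_coeIdeal _).2 ⟨r * w, Ideal.mul_mem_left _ r hw, ?_⟩
      rw [map_mul, map_mul, hr, Algebra.smul_def]
      ring
    rw [h, FractionalIdeal.mem_zero_iff, IsFractionRing.to_map_eq_zero_iff] at hmem
    exact mul_ne_zero hd0 hw0 hmem
  refine le_antisymm (fun x hx => ?_) ?_
  · by_contra hxI
    obtain ⟨⟨p, ⟨q, hq⟩⟩, hpq⟩ := IsLocalization.surj R⁰ x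
    change x * algebraMap R _ q = algebraMap R _ p at hpq
    have hD0 : algebraMap R (FractionRing R) (d * q) ≠ 0 := by
      rw [Ne, IsFractionRing.to_map_eq_zero_iff]
      exact mul_ne_zero hd0 (nonZeroDivisors.ne_zero hq)
    have hDI (i : FractionRing R) (hi : i ∈ I) :
        ∃ r : R, algebraMap R _ r = algebraMap R _ (d * q) * i := by
      obtain ⟨r, hr⟩ := hdI i hi
      refine ⟨q * r, ?_⟩
      rw [map_mul, hr, map_mul, Algebra.smul_def]
      ring
    -- `J = dq I` is integral, and `x = p / q ∉ I` becomes `dp ∉ J`.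
    let J : Ideal R :=
      { carrier := {r | ∃ i ∈ (I : Submodule R (FractionRing R)),
          algebraMap R _ r = algebraMap R _ (d * q) * i}
        add_mem' := by
          rintro v w ⟨i, hi, hv⟩ ⟨i', hi', hw⟩
          exact ⟨i + i', Submodule.add_mem _ hi hi', by rw [map_add, hv, hw, mul_add]⟩
        zero_mem' := ⟨0, Submodule.zero_mem _, by rw [map_zero, mul_zero]⟩
        smul_mem' := by
          rintro a v ⟨i, hi, hv⟩
          refine ⟨a • i, Submodule.smul_mem _ _ hi, ?_⟩
          rw [smul_eq_mul, map_mul, hv, Algebra.smul_def]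
          ring }
    have hJ0 : J ≠ ⊥ := by
      obtain ⟨i, hi, hi0⟩ : ∃ i ∈ I, i ≠ 0 := by
        by_contra! h
        exact hI (FractionalIdeal.eq_zero_iff.2 h)
      obtain ⟨r, hr⟩ := hDI i hi
      refine (Submodule.ne_bot_iff _).2 ⟨r, ⟨i, hi, hr⟩, ?_⟩
      rintro rfl
      rw [map_zero] at hr
      exact mul_ne_zero hD0 hi0 hr.symm
    have hxp : algebraMap R (FractionRing R) (d * p) = algebraMap R _ (d * q) * x := by
      rw [map_mul, ← hpq, map_mul]
      ring
    have hp : d * p ∉ J := by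
      rintro ⟨i, hi, h'⟩
      rw [hxp] at h'
      exact hxI (mul_left_cancel₀ hD0 h' ▸ hi)
    obtain ⟨y, h1, h2⟩ := h J hJ0 _ hp
    have hy : y * algebraMap R _ (d * q) ∈ (ω : FractionalIdeal R⁰ (FractionRing R)) / I := by
      refine (FractionalIdeal.mem_div_iff_of_ne_zero hI).2 fun i hi => ?_
      obtain ⟨r, hr⟩ := hDI i hi
      obtain ⟨z, hz, hz'⟩ := h1 r ⟨i, hi, hr⟩
      exact (FractionalIdeal.mem_coeIdeal _).2 ⟨z, hz, by rw [← hz', hr, mul_assoc]⟩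
    obtain ⟨z, hz, hz'⟩ := (FractionalIdeal.mem_coeIdeal _).1
      ((FractionalIdeal.mem_div_iff_of_ne_zero hJ).1 hx _ hy)
    refine h2 z hz ?_
    rw [hxp, hz']
    ring
  · rw [FractionalIdeal.le_div_iff_mul_le hJ, mul_comm,
      ← FractionalIdeal.le_div_iff_mul_le hI]

namespace semigroupRing

open PowerSeries

variable {k : Type*} [Field k] {H : AddSubmonoid ℕ} {f : ℕ}

/-- A linear functional on `k[[t]]` that is continuous for the `t`-adic topology is a coefficient
of the multiplication by a power series. -/
theorem exists_coeff_mul_eq (φ : k⟦X⟧ →ₗ[k] k) (e : ℕ) (hφ : ∀ v, φ (X ^ (e + 1) * v) = 0) :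
    ∃ y : k⟦X⟧, ∀ v, coeff e (v * y) = φ v := by
  -- Only `n ≤ e` enters coefficient `e` of a product, so the truncated subtraction beyond that is
  -- harmless.
  refine ⟨mk fun n => φ (X ^ (e - n)), fun v => ?_⟩
  have hv : φ v = ∑ i ∈ Finset.range (e + 1), coeff i v * φ (X ^ i) := by
    conv_lhs => rw [eq_X_pow_mul_shift_add_trunc (e + 1) v, map_add, hφ, zero_add,
      coe_trunc_eq_sum, map_sum]
    exact Finset.sum_congr rfl fun i _ => by rw [map_smul, smul_eq_mul]
  rw [hv, coeff_mul, Finset.Nat.sum_antidiagonal_eq_sum_range_succ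
    (fun i j => coeff i v * coeff j (mk fun n => φ (X ^ (e - n))))]
  refine Finset.sum_congr rfl fun i hi => ?_
  rw [coeff_mk, Nat.sub_sub_self (Nat.lt_succ_iff.1 (Finset.mem_range.1 hi))]

theorem coeff_mul_X_pow_sub {n N : ℕ} (h : n ≤ N) (z : k⟦X⟧) :
    coeff N (z * X ^ (N - n)) = coeff n z := by
  conv_lhs => rw [← Nat.add_sub_cancel' h, Nat.add_sub_cancel_left]
  exact coeff_mul_X_pow _ _ _

variable (k H f) in
/-- The ideal of the power series `p` such that `coeff (2 * f + 1)` vanishes on `p k[[H]]`. If `f`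
is the Frobenius number of `H` this is a canonical ideal, spanned topologically by the monomials
`t ^ (f + 1 + x)` with `f - x ∉ H`. -/
noncomputable def canonicalIdeal : Ideal (semigroupRing k H) where
  carrier := {p | ∀ r : semigroupRing k H, coeff (2 * f + 1) ((p : k⟦X⟧) * (r : k⟦X⟧)) = 0}
  add_mem' {a b} ha hb r := by
    rw [Subalgebra.coe_add, add_mul, map_add, ha r, hb r, add_zero]
  zero_mem' r := by rw [ZeroMemClass.coe_zero, zero_mul, map_zero]
  smul_mem' a p hp r := by
    have h := hp (a * r)
    rwa [Subalgebra.coe_mul, ← mul_assoc, mul_comm (p : k⟦X⟧)] at h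

theorem mem_canonicalIdeal {p : semigroupRing k H} : p ∈ canonicalIdeal k H f ↔
    ∀ r ∈ semigroupRing k H, coeff (2 * f + 1) ((p : k⟦X⟧) * r) = 0 :=
  ⟨fun h r hr => h ⟨r, hr⟩, fun h r => h r r.2⟩

/-- Test against `r = t^(2f+1-n)`, whose exponent is at least `f + 1`. Thus the choice of `2f + 1`
forces order at least `f + 1`, and membership in `k[[H]]` is automatic. -/
theorem coeff_eq_zero_of_forall (hf : ∀ m, f + 1 ≤ m → m ∈ H) {z : k⟦X⟧}
    (hz : ∀ r ∈ semigroupRing k H, coeff (2 * f + 1) (z * r) = 0) {n : ℕ} (hn : n ≤ f) :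
    coeff n z = 0 := by
  rw [← coeff_mul_X_pow_sub (show n ≤ 2 * f + 1 by lia) z]
  exact hz _ (X_pow_mem (hf _ (by lia)))

theorem mem_of_forall (hf : ∀ m, f + 1 ≤ m → m ∈ H) {z : k⟦X⟧}
    (hz : ∀ r ∈ semigroupRing k H, coeff (2 * f + 1) (z * r) = 0) : z ∈ semigroupRing k H :=
  fun n hn => coeff_eq_zero_of_forall hf hz
    (not_lt.1 fun h => hn (hf n h))

theorem X_pow_dvd_of_mem_canonicalIdeal (hf : ∀ m, f + 1 ≤ m → m ∈ H) {p : semigroupRing k H}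
    (hp : p ∈ canonicalIdeal k H f) : X ^ (f + 1) ∣ (p : k⟦X⟧) :=
  X_pow_dvd_iff.2 fun _ hm =>
    coeff_eq_zero_of_forall hf (mem_canonicalIdeal.1 hp) (Nat.lt_succ_iff.1 hm)

theorem X_pow_mem_canonicalIdeal {n : ℕ} (hn : n ≤ 2 * f + 1) (hn' : 2 * f + 1 - n ∉ H)
    (h : (X ^ n : k⟦X⟧) ∈ semigroupRing k H) :
    (⟨X ^ n, h⟩ : semigroupRing k H) ∈ canonicalIdeal k H f := by
  refine mem_canonicalIdeal.2 fun r hr => ?_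
  rw [coeff_X_pow_mul', if_pos hn]
  exact hr _ hn'

theorem canonicalIdeal_ne_bot (hf : ∀ m, f + 1 ≤ m → m ∈ H) (hf' : f ∉ H) :
    canonicalIdeal k H f ≠ ⊥ := by
  refine (Submodule.ne_bot_iff _).2 ⟨⟨X ^ (f + 1), X_pow_mem (hf _ le_rfl)⟩,
    X_pow_mem_canonicalIdeal (by lia) (by rwa [show 2 * f + 1 - (f + 1) = f by lia]) _, ?_⟩
  rw [Ne, Subtype.ext_iff]
  exact pow_ne_zero _ X_ne_zero

/-- A subspace of `k[[t]]` that is stable under `k[[H]]` and contains all power series of high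
order is closed under double duality: some `y` separates it from any given `P` outside. -/
theorem exists_separating (hf : ∀ m, f + 1 ≤ m → m ∈ H) (W : Submodule k k⟦X⟧)
    (hW : ∀ r ∈ semigroupRing k H, ∀ v ∈ W, v * r ∈ W) {a : ℕ} (ha : ∀ v, X ^ a * v ∈ W)
    {P : k⟦X⟧} (hP : P ∉ W) :
    ∃ (y : k⟦X⟧) (s : ℕ),
      (∀ v ∈ W, ∃ z : semigroupRing k H, z ∈ canonicalIdeal k H f ∧ v * y = X ^ s * (z : k⟦X⟧)) ∧
      ∀ z : semigroupRing k H, z ∈ canonicalIdeal k H f → P * y ≠ X ^ s * (z : k⟦X⟧) := by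
  obtain ⟨φ, hφP, hφ⟩ := Submodule.exists_le_ker_of_notMem hP
  -- The index is chosen so that dividing by `t^a` turns it into the `2f + 1` defining the canonical
  -- ideal.
  obtain ⟨y, hy⟩ := exists_coeff_mul_eq φ (2 * f + 1 + a) fun v => hφ (by
    rw [show 2 * f + 1 + a + 1 = a + (2 * f + 2) by lia, pow_add, mul_assoc]
    exact ha _)
  have key (v : k⟦X⟧) (hv : v ∈ W) (r : k⟦X⟧) (hr : r ∈ semigroupRing k H) :
      coeff (2 * f + 1 + a) (v * y * r) = 0 := by
    rw [mul_right_comm, hy]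
    exact hφ (hW r hr v hv)
  refine ⟨y, a, fun v hv => ?_, fun z hz h => hφP ?_⟩
  · obtain ⟨z, hz⟩ : X ^ a ∣ v * y := X_pow_dvd_iff.2 fun m hm => by
      rw [← coeff_mul_X_pow_sub (show m ≤ 2 * f + 1 + a by lia)]
      exact key v hv _ (X_pow_mem (hf _ (by lia)))
    have hz' (r : k⟦X⟧) (hr : r ∈ semigroupRing k H) : coeff (2 * f + 1) (z * r) = 0 := by
      rw [← coeff_X_pow_mul (z * r) a, ← mul_assoc, ← hz]
      exact key v hv r hr
    exact ⟨⟨z, mem_of_forall hf hz'⟩, mem_canonicalIdeal.2 hz', hz⟩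
  · rw [← hy, h, coeff_X_pow_mul]
    simpa using mem_canonicalIdeal.1 hz 1 (one_mem _)

theorem exists_dvd_X_pow {v : k⟦X⟧} (hv : v ≠ 0) : ∃ n : ℕ, v ∣ X ^ n := by
  obtain ⟨n, hn⟩ := IsDiscreteValuationRing.associated_pow_irreducible hv
    (PowerSeries.X_prime (R := k)).irreducible
  exact ⟨n, hn.dvd⟩

theorem map_div_map_mul_eq_iff {V Q : Type*} [CommRing V] [Field Q] (j : V →+* Q)
    (hj : Function.Injective j) {y t p z : V} (ht : t ≠ 0) :
    j y / j t * j p = j z ↔ p * y = t * z := by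
  have hT : j t ≠ 0 := (map_ne_zero_iff j hj).2 ht
  rw [← hj.eq_iff, map_mul, map_mul, div_mul_eq_mul_div, div_eq_iff hT, mul_comm,
    mul_comm (j z)]

theorem toFrac_div_mul_eq_iff (hf : ∀ m, f + 1 ≤ m → m ∈ H) {y : k⟦X⟧} {s : ℕ}
    {p z : semigroupRing k H} :
    toFrac hf y / toFrac hf (X ^ s) * algebraMap _ _ p = algebraMap _ _ z ↔
      (p : k⟦X⟧) * y = X ^ s * (z : k⟦X⟧) := by
  rw [← toFrac_coe hf p, ← toFrac_coe hf z]
  have hs : (X ^ s : k⟦X⟧) ≠ 0 := pow_ne_zero s X_ne_zero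
  exact map_div_map_mul_eq_iff (toFrac hf) (toFrac_injective hf) hs

theorem isCanonicalIdeal_canonicalIdeal (hf : ∀ m, f + 1 ≤ m → m ∈ H) (hf' : f ∉ H) :
    IsCanonicalIdeal (semigroupRing k H) (canonicalIdeal k H f) := by
  refine isCanonicalIdeal_of_separating (canonicalIdeal_ne_bot hf hf') fun J hJ p hp => ?_
  let W : Submodule k k⟦X⟧ := (J.restrictScalars k).map (semigroupRing k H).val.toLinearMap
  have hW : ∀ r ∈ semigroupRing k H, ∀ v ∈ W, v * r ∈ W := by
    rintro r hr _ ⟨v, hv, rfl⟩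
    exact ⟨v * ⟨r, hr⟩, J.mul_mem_right _ hv, rfl⟩
  -- A nonzero `r ∈ J` divides some `t^n` in `k[[t]]`; the extra factor `t^(f+1)` brings the
  -- cofactor into `k[[H]]`.
  obtain ⟨a, ha⟩ : ∃ a : ℕ, ∀ v, X ^ a * v ∈ W := by
    obtain ⟨r, hr, hr0⟩ := (Submodule.ne_bot_iff _).1 hJ
    obtain ⟨n, u, hu⟩ := exists_dvd_X_pow (v := (r : k⟦X⟧)) fun h => hr0 (Subtype.ext h)
    refine ⟨n + (f + 1), fun v => ?_⟩
    rw [pow_add, hu,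
      show (r : k⟦X⟧) * u * X ^ (f + 1) * v =
        (r : k⟦X⟧) * (X ^ (f + 1) * (u * v)) by ring]
    exact hW _ (X_pow_mul_mem hf _) _ ⟨r, hr, rfl⟩
  have hP : (p : k⟦X⟧) ∉ W := by
    rintro ⟨v, hv, hvp⟩
    exact hp (Subtype.ext (a1 := v) (a2 := p) hvp ▸ hv)
  obtain ⟨y, s, h1, h2⟩ := exists_separating hf W hW ha hP
  refine ⟨toFrac hf y / toFrac hf (X ^ s), fun v hv => ?_, fun z hz h => h2 z hz ?_⟩
  · obtain ⟨z, hz, h⟩ := h1 v ⟨v, hv, rfl⟩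
    exact ⟨z, hz, (toFrac_div_mul_eq_iff hf).2 h⟩
  · exact (toFrac_div_mul_eq_iff hf).1 h

end semigroupRing

/-- Double duality at `I = R` reads `ω : ω = R`. -/
theorem IsCanonicalIdeal.mem_range_of_mul_mem {R : Type*} [CommRing R] [IsDomain R] {ω : Ideal R}
    (hω : IsCanonicalIdeal R ω) {x : FractionRing R}
    (hx : ∀ z ∈ ω, ∃ z' ∈ ω, algebraMap R _ z' = x * algebraMap R _ z) :
    x ∈ Set.range (algebraMap R (FractionRing R)) := by
  have hωω := hω.2 1 one_ne_zero
  rw [FractionalIdeal.div_one] at hωω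
  refine (FractionalIdeal.mem_one_iff R⁰).1 ?_
  rw [← hωω, FractionalIdeal.mem_div_iff_of_ne_zero (FractionalIdeal.coeIdeal_ne_zero.2 hω.1)]
  intro y hy
  obtain ⟨z, hz, rfl⟩ := (FractionalIdeal.mem_coeIdeal _).1 hy
  exact (FractionalIdeal.mem_coeIdeal _).2 (hx z hz)

/-! ### Blowup algebras and their conductors. -/

namespace semigroupRing

open PowerSeries

variable {k : Type*} [Field k] {H : AddSubmonoid ℕ} {f : ℕ}

theorem X_pow_mem_iff {n : ℕ} : (X ^ n : k⟦X⟧) ∈ semigroupRing k H ↔ n ∈ H := by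
  refine ⟨fun h => ?_, X_pow_mem⟩
  by_contra hn
  exact one_ne_zero ((coeff_X_pow_self n).symm.trans (h n hn))

theorem X_pow_dvd_of_mem_canonicalIdeal_pow (hf : ∀ m, f + 1 ≤ m → m ∈ H) {n : ℕ}
    {p : semigroupRing k H} (hp : p ∈ canonicalIdeal k H f ^ n) :
    X ^ ((f + 1) * n) ∣ (p : k⟦X⟧) := by
  have h : canonicalIdeal k H f ≤
      (Ideal.span {(X ^ (f + 1) : k⟦X⟧)}).comap (semigroupRing k H).val := fun q hq =>
    Ideal.mem_span_singleton.2 (X_pow_dvd_of_mem_canonicalIdeal hf hq)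
  have h' := Ideal.le_comap_pow _ n (Ideal.pow_right_mono h n hp)
  rw [Ideal.span_singleton_pow, ← pow_mul] at h'
  exact Ideal.mem_span_singleton.1 h'

/-- If `f - 1 ∉ H`, then a power of the canonical ideal is an ideal of `k[[t]]`. -/
theorem exists_mem_canonicalIdeal_pow (hf : ∀ m, f + 1 ≤ m → m ∈ H) (hf' : f ∉ H)
    (hf'' : f - 1 ∉ H) (v : k⟦X⟧) :
    ∃ w ∈ canonicalIdeal k H f ^ f, (w : k⟦X⟧) = X ^ ((f + 1) * f) * v := by
  have hf0 : f ≠ 0 := fun h => hf' (h ▸ H.zero_mem)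
  have h1 : (⟨X ^ (f + 1), X_pow_mem (hf _ le_rfl)⟩ : semigroupRing k H) ∈ canonicalIdeal k H f :=
    X_pow_mem_canonicalIdeal (by lia) (by rwa [show 2 * f + 1 - (f + 1) = f by lia]) _
  have h2 : (⟨X ^ (f + 2), X_pow_mem (hf _ (by lia))⟩ : semigroupRing k H) ∈
      canonicalIdeal k H f :=
    X_pow_mem_canonicalIdeal (by lia) (by rwa [show 2 * f + 1 - (f + 2) = f - 1 by lia]) _
  have h3 (i : ℕ) (hi : i ≤ f) :
      ∃ w ∈ canonicalIdeal k H f ^ f, (w : k⟦X⟧) = X ^ ((f + 1) * f + i) := by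
    -- The product of `f - i` factors `t^(f+1)` and `i` factors `t^(f+2)`. The exponents `i ≤ f`
    -- suffice, since `t^(f+1) k[[t]]` lies in `k[[H]]`.
    have h := Ideal.mul_mem_mul (Ideal.pow_mem_pow h1 (f - i)) (Ideal.pow_mem_pow h2 i)
    rw [← pow_add, Nat.sub_add_cancel hi] at h
    refine ⟨_, h, ?_⟩
    rw [Subalgebra.coe_mul, Subalgebra.coe_pow, Subalgebra.coe_pow, ← pow_mul, ← pow_mul,
      ← pow_add]
    congr 1
    obtain ⟨j, rfl⟩ := Nat.exists_eq_add_of_le hi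
    rw [Nat.add_sub_cancel_left]
    ring
  let W : Submodule k k⟦X⟧ :=
    ((canonicalIdeal k H f ^ f).restrictScalars k).map (semigroupRing k H).val.toLinearMap
  suffices h : X ^ ((f + 1) * f) * v ∈ W by
    obtain ⟨w, hw, hwv⟩ := h
    exact ⟨w, hw, hwv⟩
  rw [eq_X_pow_mul_shift_add_trunc (f + 1) v, mul_add]
  refine W.add_mem ?_ ?_
  · obtain ⟨w, hw, hw'⟩ := h3 0 (Nat.zero_le f)
    exact ⟨w * ⟨_, X_pow_mul_mem hf _⟩, Ideal.mul_mem_right _ _ hw, congrArg (· * _) hw'⟩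
  · rw [coe_trunc_eq_sum, Finset.mul_sum]
    refine W.sum_mem fun i hi => ?_
    rw [mul_smul_comm, ← pow_add]
    obtain ⟨w, hw, hw'⟩ := h3 i (Nat.lt_succ_iff.1 (Finset.mem_range.1 hi))
    exact W.smul_mem _ ⟨w, hw, hw'⟩

theorem blowupAlgebra_canonicalIdeal (hf : ∀ m, f + 1 ≤ m → m ∈ H) (hf' : f ∉ H)
    (hf'' : f - 1 ∉ H) :
    blowupAlgebra (semigroupRing k H) (canonicalIdeal k H f) =
      integralClosure (semigroupRing k H) (FractionRing (semigroupRing k H)) := by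
  ext x
  rw [mem_integralClosure_iff hf]
  constructor
  · rintro ⟨n, hn⟩
    have h1 : (⟨X ^ (f + 1), X_pow_mem (hf _ le_rfl)⟩ : semigroupRing k H) ∈
        canonicalIdeal k H f :=
      X_pow_mem_canonicalIdeal (by lia) (by rwa [show 2 * f + 1 - (f + 1) = f by lia]) _
    obtain ⟨w, hw, hw'⟩ := hn _ ⟨_, Ideal.pow_mem_pow h1 n, rfl⟩
    obtain ⟨v, hv⟩ := X_pow_dvd_of_mem_canonicalIdeal_pow hf hw
    refine ⟨v, ?_⟩
    have hX : toFrac hf (X ^ ((f + 1) * n) : k⟦X⟧) ≠ 0 := fun h =>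
      pow_ne_zero _ X_ne_zero (toFrac_injective hf (h.trans (map_zero _).symm))
    refine mul_left_cancel₀ hX ?_
    rw [← map_mul, ← hv, toFrac_coe, mul_comm _ x]
    refine Eq.trans hw' (congrArg (x * ·) ?_)
    rw [Algebra.linearMap_apply, ← toFrac_coe hf, Subalgebra.coe_pow, ← pow_mul]
  · rintro ⟨v, rfl⟩
    refine ⟨f, ?_⟩
    rintro _ ⟨p, hp, rfl⟩
    obtain ⟨u, hu⟩ := X_pow_dvd_of_mem_canonicalIdeal_pow hf hp
    obtain ⟨w, hw, hw'⟩ := exists_mem_canonicalIdeal_pow hf hf' hf'' (v * u)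
    refine ⟨w, hw, ?_⟩
    rw [Algebra.linearMap_apply, Algebra.linearMap_apply, ← toFrac_coe hf, ← toFrac_coe hf,
      ← map_mul, hw', hu, mul_left_comm]

/-- An element of least order works, divisibility in `k[[t]]` being total and well-founded. -/
theorem exists_dvd_forall {ω : Ideal (semigroupRing k H)} (hω : ω ≠ ⊥) :
    ∃ g ∈ ω, g ≠ 0 ∧ ∀ w ∈ ω, (g : k⟦X⟧) ∣ w := by
  obtain ⟨g₀, hg₀, hg₀'⟩ := (Submodule.ne_bot_iff _).1 hω
  obtain ⟨_, ⟨g, hg, hg0, rfl⟩, hmin⟩ := (wellFounded_dvdNotUnit (α := k⟦X⟧)).has_min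
    {v | ∃ g ∈ ω, g ≠ 0 ∧ (g : k⟦X⟧) = v} ⟨g₀, g₀, hg₀, hg₀', rfl⟩
  refine ⟨g, hg, hg0, fun w hw => ?_⟩
  by_contra h
  have hw0 : w ≠ 0 := by
    rintro rfl
    exact h (dvd_zero _)
  exact hmin w ⟨w, hw, hw0, rfl⟩ (dvdNotUnit_of_dvd_of_not_dvd
    ((ValuationRing.dvd_total (g : k⟦X⟧) w).resolve_left h) h)

/-- Series without `t`-term are closed under sums and products; `1 ∉ H` handles `n = 0`. -/
theorem exists_eq_pow_mul_of_mem_pow (h1 : 1 ∉ H) {ω : Ideal (semigroupRing k H)} {g : k⟦X⟧}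
    (hω : ∀ w ∈ ω, ∃ v, (w : k⟦X⟧) = g * v ∧ coeff 1 v = 0) (n : ℕ) :
    ∀ w ∈ ω ^ n, ∃ v, (w : k⟦X⟧) = g ^ n * v ∧ coeff 1 v = 0 := by
  induction n with
  | zero => exact fun w _ => ⟨w, by rw [pow_zero, one_mul], w.2 1 h1⟩
  | succ n ih =>
    intro w hw
    rw [pow_succ] at hw
    refine Submodule.mul_induction_on hw (fun a ha b hb => ?_) ?_
    · obtain ⟨v, hv, hv1⟩ := ih a ha
      obtain ⟨v', hv', hv1'⟩ := hω b hb
      refine ⟨v * v', by rw [Subalgebra.coe_mul, hv, hv']; ring, ?_⟩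
      rw [coeff_mul, Finset.Nat.sum_antidiagonal_eq_sum_range_succ
        (fun i j => coeff i v * coeff j v')]
      simp [Finset.sum_range_succ, hv1, hv1']
    · rintro a b ⟨v, hv, hv1⟩ ⟨v', hv', hv1'⟩
      exact ⟨v + v', by rw [Subalgebra.coe_add, hv, hv']; ring, by rw [map_add, hv1, hv1', add_zero]⟩

theorem X_pow_mul_mem_of_coeff_one (hf : ∀ m, f + 1 ≤ m → m ∈ H) (hf' : f - 1 ∈ H) {v : k⟦X⟧}
    (hv : coeff 1 v = 0) : X ^ (f - 1) * v ∈ semigroupRing k H := by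
  intro m hm
  have hm' : m ≤ f := not_lt.1 fun h => hm (hf m h)
  have hm1 : m ≠ f - 1 := fun h => hm (h ▸ hf')
  rw [coeff_X_pow_mul']
  split_ifs with h
  · rw [show m - (f - 1) = 1 by lia, hv]
  · rfl

/-- The aim is `t^f ω ⊆ ω`, whence `t^f ∈ ω : ω = R`. With `v = v₀ + t u` and `u` a unit, `t^(f-1)
(w - v₀ g) = g t^f u` lies in `ω`. -/
theorem X_pow_mem_of_isCanonicalIdeal (hf : ∀ m, f + 1 ≤ m → m ∈ H) (hf0 : f ≠ 0)
    (hf' : f - 1 ∈ H) {ω : Ideal (semigroupRing k H)}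
    (hω : IsCanonicalIdeal (semigroupRing k H) ω) {g w : semigroupRing k H} (hg : g ∈ ω)
    (hgω : ∀ w ∈ ω, (g : k⟦X⟧) ∣ w) {v : k⟦X⟧} (hw : w ∈ ω) (hwv : (w : k⟦X⟧) = g * v)
    (hv : coeff 1 v ≠ 0) : f ∈ H := by
  obtain ⟨u, hu⟩ : ∃ u, u = mk fun n => coeff (n + 1) v := ⟨_, rfl⟩
  have hvu : v = X * u + C (constantCoeff v) := hu ▸ eq_X_mul_shift_add_const v
  obtain ⟨u', hu'⟩ : ∃ u', u * u' = 1 := by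
    refine isUnit_iff_exists_inv.1 (isUnit_iff_constantCoeff.2 ?_)
    rw [← coeff_zero_eq_constantCoeff_apply, hu, coeff_mk]
    exact hv.isUnit
  have hC (a : k) : C a ∈ semigroupRing k H := (semigroupRing k H).algebraMap_mem a
  have hpow : (X : k⟦X⟧) ^ f = X ^ (f - 1) * X := by
    rw [← pow_succ, Nat.sub_add_cancel (Nat.pos_of_ne_zero hf0)]
  obtain ⟨w', hw', hww'⟩ : ∃ w' ∈ ω, (w' : k⟦X⟧) = (g : k⟦X⟧) * (X ^ f * u) := by
    refine ⟨⟨X ^ (f - 1), X_pow_mem hf'⟩ * (w - ⟨_, hC (constantCoeff v)⟩ * g),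
      ω.mul_mem_left _ (ω.sub_mem hw (ω.mul_mem_left _ hg)), ?_⟩
    rw [Subalgebra.coe_mul, Subalgebra.coe_sub, Subalgebra.coe_mul, hwv, hpow]
    linear_combination (X ^ (f - 1) * (g : k⟦X⟧)) * hvu
  -- For `z = g v'`, write `v' = u (a + t q)` with `a` constant; then `t^f z = a (g t^f u) +
  -- (t^(f+1) u q) g`.
  have key (z : semigroupRing k H) (hz : z ∈ ω) :
      ∃ z' ∈ ω, (z' : k⟦X⟧) = X ^ f * (z : k⟦X⟧) := by
    obtain ⟨v', hv'⟩ := hgω z hz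
    have hq := eq_X_mul_shift_add_const (u' * v')
    set q : k⟦X⟧ := mk fun n => coeff (n + 1) (u' * v')
    refine ⟨⟨_, hC (constantCoeff (u' * v'))⟩ * w' + ⟨_, X_pow_mul_mem hf (u * q)⟩ * g,
      ω.add_mem (ω.mul_mem_left _ hw') (ω.mul_mem_left _ hg), ?_⟩
    rw [Subalgebra.coe_add, Subalgebra.coe_mul, Subalgebra.coe_mul, hww', hv']
    linear_combination (-(g : k⟦X⟧) * X ^ f * u) * hq + (g : k⟦X⟧) * X ^ f * v' * hu'
  refine X_pow_mem_iff.1 ((toFrac_mem_range_iff (k := k) hf).1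
    (hω.mem_range_of_mul_mem fun z hz => ?_))
  obtain ⟨z', hz', h⟩ := key z hz
  refine ⟨z', hz', ?_⟩
  rw [← toFrac_coe hf, ← toFrac_coe hf, h, map_mul]

theorem not_mem_of_hasMinimalCanonicalConductor (hf : ∀ m, f + 1 ≤ m → m ∈ H) (hf' : f ∉ H)
    (h : HasMinimalCanonicalConductor (semigroupRing k H)) : f - 1 ∉ H := by
  intro hf1
  have hf0 : f ≠ 0 := fun h => hf' (h ▸ H.zero_mem)
  have h1 : 1 ∉ H := fun h1 => hf' (by simpa using H.nsmul_mem h1 f)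
  obtain ⟨ω, hω, hco⟩ := h
  obtain ⟨g, hg, hg0, hgω⟩ := exists_dvd_forall hω.1
  have hcoeff : ∀ w ∈ ω, ∃ v, (w : k⟦X⟧) = g * v ∧ coeff 1 v = 0 := by
    intro w hw
    obtain ⟨v, hv⟩ := hgω w hw
    refine ⟨v, hv, ?_⟩
    by_contra hv1
    exact hf' (X_pow_mem_of_isCanonicalIdeal hf hf0 hf1 hω hg hgω hw hv hv1)
  have hmem : toFrac hf (X ^ (f - 1) : k⟦X⟧) ∈
      birationalConductor (semigroupRing k H) (blowupAlgebra (semigroupRing k H) ω) := by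
    constructor
    · rw [toFrac_of_mem hf (X_pow_mem hf1)]
      exact Subalgebra.algebraMap_mem _ _
    · rintro s ⟨n, hn⟩
      obtain ⟨w, hw, hw'⟩ := hn _ ⟨_, Ideal.pow_mem_pow hg n, rfl⟩
      obtain ⟨v, hv, hv1⟩ := exists_eq_pow_mul_of_mem_pow h1 hcoeff n w hw
      have hgn : toFrac hf ((g : k⟦X⟧) ^ n) ≠ 0 := fun h =>
        pow_ne_zero n (fun h => hg0 (Subtype.ext h))
          (toFrac_injective hf (h.trans (map_zero _).symm))
      have hs : toFrac hf v = s := by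
        refine mul_left_cancel₀ hgn ?_
        rw [← map_mul, ← hv, toFrac_coe, mul_comm _ s]
        refine Eq.trans hw' (congrArg (s * ·) ?_)
        rw [Algebra.linearMap_apply, ← toFrac_coe hf, Subalgebra.coe_pow]
      rw [← hs, ← map_mul, toFrac_mem_range_iff]
      exact X_pow_mul_mem_of_coeff_one hf hf1 hv1
  rw [hco] at hmem
  have h := hmem.2 _ ((mem_integralClosure_iff hf).2 ⟨X, rfl⟩)
  rw [← map_mul, toFrac_mem_range_iff, ← pow_succ,
    Nat.sub_add_cancel (Nat.pos_of_ne_zero hf0), X_pow_mem_iff] at h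
  exact hf' h

end semigroupRing

/-- Since `1 ∈ H` would force `f ∈ H`, a nonzero `m ∈ H` is at least `2`, and `f - 1 + m` exceeds
`f`. -/
theorem sub_one_mem_quasiFrobeniusNumbers_iff {H : AddSubmonoid ℕ} {f : ℕ}
    (hf : ∀ m, f + 1 ≤ m → m ∈ H) (hf' : f ∉ H) :
    f - 1 ∈ quasiFrobeniusNumbers H ↔ f - 1 ∉ H := by
  refine ⟨fun h => h.1, fun h => ⟨h, fun m hm hm0 => hf _ ?_⟩⟩
  have hm1 : m ≠ 1 := by
    rintro rfl
    exact hf' (by simpa using H.nsmul_mem hm f)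
  lia

theorem mainTheorem2 (k : Type*) [Field k] (H : AddSubmonoid ℕ) (f : ℕ)
    (hH : {n : ℕ | n ∉ H}.Finite) (hf : FrobeniusNumber f (H : Set ℕ)) :
    HasMinimalCanonicalConductor (semigroupRing k H) ↔ f - 1 ∈ quasiFrobeniusNumbers H := by
  rw [frobeniusNumber_iff, AddSubmonoid.closure_eq] at hf
  obtain ⟨hf', hf⟩ := hf
  rw [sub_one_mem_quasiFrobeniusNumbers_iff hf hf']
  refine ⟨semigroupRing.not_mem_of_hasMinimalCanonicalConductor hf hf', fun h =>
    ⟨_, semigroupRing.isCanonicalIdeal_canonicalIdeal hf hf', ?_⟩⟩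
  rw [semigroupRing.blowupAlgebra_canonicalIdeal hf hf' h]
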